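/- Let $H$ be a separable complex Hilbert space (finite or infinite dimensional) and let $\mathbb{P}H$ be the projective space of complex lines in $H$. For lines $L_1, L_2$ with unit vectors $\psi_i \in L_i$, let $p(L_1,L_2) = |\langle \psi_1, \psi_2\rangle|^2$ be the transition probability. Under the canonical identification $T_L\mathbb{P}H \cong \operatorname{Hom}_{\mathbb{C}}(L, L^\perp)$, the Fubini–Study hermitian metric is $\langle f_1, f_2\rangle = c\,\operatorname{Tr}(f_1^* f_2)$, where $c>0$ is a constant fixing the normalization; let $d$ be the distance function of the underlying Riemannian metric, that is, $d(K,L)$ is the infimum of the lengths of the $C^1$ curves in $\mathbb{P}H$ from $K$ to $L$. Then, for every $c>0$, the group of quantum symmetries of $(\mathbb{P}H, p)$, that is, the group of all bijections $\phi\colon \mathbb{P}H \to \mathbb{P}H$ with $p(\phi(K),\phi(L)) = p(K,L)$ for all $K, L \in \mathbb{P}H$, is equal to the group of isometries of $\mathbb{P}H$ for the Fubini–Study distance, that is, the group of all bijections $\phi\colon \mathbb{P}H \to \mathbb{P}H$ with $d(\phi(K),\phi(L)) = d(K,L)$ for all $K, L \in \mathbb{P}H$. -/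

import Mathlib

open scoped LinearAlgebra.Projectivization ENNReal
open Set MeasureTheory

namespace QuantumGeometry

noncomputable section

/-- The group of all bijections of `X` preserving a two-variable function `f` on `X`. -/
def symmetryGroup {X : Type*} (f : X → X → ℝ) : Subgroup (Equiv.Perm X) where
  carrier := {φ | ∀ x y, f (φ x) (φ y) = f x y}
  one_mem' := fun _ _ => rfl
  mul_mem' := fun {a b} ha hb x y => (ha (b x) (b y)).trans (hb x y)
  inv_mem' := fun {a} ha x y => by
    have h := ha (a⁻¹ x) (a⁻¹ y)
    simpa using h.symm

section

variable {H : Type*} [NormedAddCommGroup H] [InnerProductSpace ℂ H]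

/-! ### The transition probability -/

/-- The transition probability `p(L₁, L₂) = |⟨ψ₁, ψ₂⟩|²`, `ψᵢ` being a unit vector of `Lᵢ`. -/
def transitionProb (L₁ L₂ : ℙ ℂ H) : ℝ :=
  ‖inner ℂ ((‖L₁.rep‖⁻¹ : ℂ) • L₁.rep) ((‖L₂.rep‖⁻¹ : ℂ) • L₂.rep)‖ ^ 2

/-- The transition probability may be computed with any unit vectors of the two lines. -/
theorem transitionProb_eq {L₁ L₂ : ℙ ℂ H} {ψ₁ ψ₂ : H} (h₁ : ψ₁ ∈ L₁.submodule)
    (h₂ : ψ₂ ∈ L₂.submodule) (n₁ : ‖ψ₁‖ = 1) (n₂ : ‖ψ₂‖ = 1) :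
    transitionProb L₁ L₂ = ‖inner ℂ ψ₁ ψ₂‖ ^ 2 := by
  rw [Projectivization.submodule_eq, Submodule.mem_span_singleton] at h₁ h₂
  obtain ⟨a, rfl⟩ := h₁
  obtain ⟨b, rfl⟩ := h₂
  rw [norm_smul] at n₁ n₂
  have ha : ‖a‖ = ‖L₁.rep‖⁻¹ := eq_inv_of_mul_eq_one_left n₁
  have hb : ‖b‖ = ‖L₂.rep‖⁻¹ := eq_inv_of_mul_eq_one_left n₂
  rw [inner_smul_left, inner_smul_right, transitionProb, inner_smul_left, inner_smul_right]
  simp [ha, hb]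

/-- The group of quantum symmetries of `(ℙH, p)`. -/
def quantumSymmetryGroup (H : Type*) [NormedAddCommGroup H] [InnerProductSpace ℂ H] :
    Subgroup (Equiv.Perm (ℙ ℂ H)) :=
  symmetryGroup transitionProb

/-! ### Tangent spaces and charts of the projective space -/

/-- The tangent space of `ℙH` at the line `L`, that is `Hom(L, Lᗮ)`. -/
abbrev Tangent (L : ℙ ℂ H) : Type _ :=
  L.submodule →L[ℂ] L.submoduleᗮ

theorem rep_mem (L : ℙ ℂ H) : L.rep ∈ L.submodule := by
  rw [Projectivization.submodule_eq]
  exact Submodule.mem_span_singleton_self _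

theorem proj_add (L : ℙ ℂ H) (v : L.submodule) (w : L.submoduleᗮ) :
    L.submodule.orthogonalProjectionOnto ((v : H) + w) = v := by
  simp

theorem projPerp_add (L : ℙ ℂ H) (v : L.submodule) (w : L.submoduleᗮ) :
    L.submoduleᗮ.orthogonalProjectionOnto ((v : H) + w) = w := by
  rw [map_add, Submodule.orthogonalProjectionOnto_orthogonal_apply_eq_zero v.2]
  simp

theorem graph_ne_zero (L : ℙ ℂ H) (f : Tangent L) :
    L.rep + (f ⟨L.rep, rep_mem L⟩ : H) ≠ 0 := fun h => by
  have h2 := proj_add L ⟨L.rep, rep_mem L⟩ (f ⟨L.rep, rep_mem L⟩)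
  rw [show ((⟨L.rep, rep_mem L⟩ : L.submodule) : H) = L.rep from rfl, h, map_zero] at h2
  exact L.rep_nonzero (congrArg Subtype.val h2.symm)

/-- The graph of `f : L → Lᗮ`, a line in `H = L ⊕ Lᗮ`. -/
def graphLine (L : ℙ ℂ H) (f : Tangent L) : ℙ ℂ H :=
  Projectivization.mk ℂ (L.rep + (f ⟨L.rep, rep_mem L⟩ : H)) (graph_ne_zero L f)

theorem exists_smul_rep (L : ℙ ℂ H) (v : L.submodule) :
    ∃ c : ℂ, v = c • (⟨L.rep, rep_mem L⟩ : L.submodule) := by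
  obtain ⟨v, hv⟩ := v
  rw [Projectivization.submodule_eq, Submodule.mem_span_singleton] at hv
  obtain ⟨c, rfl⟩ := hv
  exact ⟨c, rfl⟩

theorem mem_graphLine (L : ℙ ℂ H) (f : Tangent L) (x : H) :
    x ∈ (graphLine L f).submodule ↔ ∃ v : L.submodule, (v : H) + (f v : H) = x := by
  rw [graphLine, Projectivization.submodule_mk, Submodule.mem_span_singleton]
  constructor
  · rintro ⟨c, rfl⟩
    exact ⟨c • ⟨L.rep, rep_mem L⟩, by rw [map_smul, smul_add]; rfl⟩
  · rintro ⟨v, rfl⟩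
    obtain ⟨c, rfl⟩ := exists_smul_rep L v
    exact ⟨c, by rw [map_smul, smul_add]; rfl⟩

/-- The linear map `L → Lᗮ` whose graph is the line `K`, if `K` is not orthogonal to `L`
(and `0` otherwise). -/
def graphCoord (L K : ℙ ℂ H) : Tangent L :=
  (innerSL ℂ (L.submodule.orthogonalProjectionOnto K.rep)).smulRight
    (((‖L.submodule.orthogonalProjectionOnto K.rep‖ : ℂ) ^ 2)⁻¹ •
      L.submoduleᗮ.orthogonalProjectionOnto K.rep)

theorem graphCoord_apply (L K : ℙ ℂ H)
    (h : L.submodule.orthogonalProjectionOnto K.rep ≠ 0) :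
    graphCoord L K (L.submodule.orthogonalProjectionOnto K.rep) =
      L.submoduleᗮ.orthogonalProjectionOnto K.rep := by
  have h2 : ((‖L.submodule.orthogonalProjectionOnto K.rep‖ : ℂ)) ≠ 0 := by
    exact_mod_cast norm_ne_zero_iff.2 h
  rw [graphCoord, ContinuousLinearMap.smulRight_apply, innerSL_apply_apply,
    inner_self_eq_norm_sq_to_K, smul_smul]
  erw [mul_inv_cancel₀ (pow_ne_zero 2 h2)]
  rw [one_smul]

theorem not_isOrtho_iff (L K : ℙ ℂ H) :
    ¬ K.submodule ⟂ L.submodule ↔ L.submodule.orthogonalProjectionOnto K.rep ≠ 0 := by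
  rw [not_iff_not, Submodule.orthogonalProjectionOnto_eq_zero_iff, Submodule.isOrtho_iff_le,
    Projectivization.submodule_eq K, Submodule.span_singleton_le_iff_mem]

theorem tangent_ext (L : ℙ ℂ H) (f g : Tangent L) (v : L.submodule) (hv : v ≠ 0)
    (h : f v = g v) : f = g := by
  ext1 w
  obtain ⟨c, rfl⟩ := exists_smul_rep L v
  obtain ⟨d, rfl⟩ := exists_smul_rep L w
  have hc : c ≠ 0 := fun hc => hv (by rw [hc, zero_smul])
  rw [map_smul, map_smul] at h
  rw [map_smul, map_smul, smul_right_injective _ hc h]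

/-- The affine chart of `ℙH` centred at `L`, with values in the tangent space at `L`: it is
defined on the lines that are not orthogonal to `L`, and its inverse sends `f` to its graph. -/
def graphChart (L : ℙ ℂ H) : PartialEquiv (ℙ ℂ H) (Tangent L) where
  toFun := graphCoord L
  invFun := graphLine L
  source := {K | ¬ K.submodule ⟂ L.submodule}
  target := univ
  map_source' := fun _ _ => mem_univ _
  map_target' := fun f _ => by
    intro h
    rw [Submodule.isOrtho_iff_le] at h
    have h1 := h ((mem_graphLine L f _).2 ⟨⟨L.rep, rep_mem L⟩, rfl⟩)
    rw [← Submodule.orthogonalProjectionOnto_eq_zero_iff, proj_add] at h1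
    exact L.rep_nonzero (congrArg Subtype.val h1)
  left_inv' := fun K hK => by
    have hK' := (not_isOrtho_iff L K).1 hK
    have h1 : K.rep ∈ (graphLine L (graphCoord L K)).submodule := by
      rw [mem_graphLine]
      refine ⟨L.submodule.orthogonalProjectionOnto K.rep, ?_⟩
      rw [graphCoord_apply L K hK']
      exact Submodule.starProjection_add_starProjection_orthogonal (K := L.submodule) K.rep
    rw [graphLine, Projectivization.submodule_mk, Submodule.mem_span_singleton] at h1
    obtain ⟨c, hc⟩ := h1
    rw [← Projectivization.mk_rep K]
    refine ((Projectivization.mk_eq_mk_iff' ℂ _ _ _ _).2 ⟨c, ?_⟩).symm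
    simpa using hc
  right_inv' := fun f _ => by
    obtain ⟨v, hv⟩ := (mem_graphLine L f _).1 (rep_mem (graphLine L f))
    have hv0 : v ≠ 0 := by
      rintro rfl
      apply (graphLine L f).rep_nonzero
      rw [← hv]
      simp
    have e1 : L.submodule.orthogonalProjectionOnto (graphLine L f).rep = v := by
      rw [← hv, proj_add]
    have e2 : L.submoduleᗮ.orthogonalProjectionOnto (graphLine L f).rep = f v := by
      rw [← hv, projPerp_add]
    have h := graphCoord_apply L (graphLine L f) (by rwa [e1])
    rw [e1, e2] at h
    exact tangent_ext L _ _ v hv0 h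

/-! ### The Fubini-Study metric and its distance function -/

/-- A curve `γ : [0, 1] → ℙH` is continuously differentiable if near each time `t` it is so in
the chart centred at `γ t`. -/
def IsC1Curve (γ : ℝ → ℙ ℂ H) : Prop :=
  ∀ t ∈ Icc (0 : ℝ) 1,
    (∀ᶠ s in nhdsWithin t (Icc 0 1), γ s ∈ (graphChart (γ t)).source) ∧
      ContDiffWithinAt ℝ 1 (fun s => graphChart (γ t) (γ s)) (Icc 0 1) t

/-- The velocity at time `t` of a curve in `ℙH`, computed in the chart centred at `γ t`. -/
def velocity (γ : ℝ → ℙ ℂ H) (t : ℝ) : Tangent (γ t) :=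
  derivWithin (fun s => graphChart (γ t) (γ s)) (Icc 0 1) t

variable [CompleteSpace H]

/-- The Fubini-Study hermitian metric `⟨f₁, f₂⟩ = c · Tr(f₁* f₂)` on the tangent space
`Hom(L, Lᗮ)`, the constant `c > 0` being the normalization. -/
def fubiniStudyInner (c : ℝ) (L : ℙ ℂ H) (f₁ f₂ : Tangent L) : ℂ :=
  haveI : CompleteSpace L.submodule := FiniteDimensional.complete ℂ L.submodule
  c * LinearMap.trace ℂ L.submodule
    ((ContinuousLinearMap.adjoint f₁ ∘L f₂ : L.submodule →L[ℂ] L.submodule) :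
      L.submodule →ₗ[ℂ] L.submodule)

/-- The length of a tangent vector for the Riemannian metric underlying the Fubini-Study
metric. -/
def fubiniStudyNorm (c : ℝ) (L : ℙ ℂ H) (f : Tangent L) : ℝ :=
  √(fubiniStudyInner c L f f).re

/-- The Fubini-Study length of a curve `[0, 1] → ℙH`. -/
def fubiniStudyLength (c : ℝ) (γ : ℝ → ℙ ℂ H) : ℝ≥0∞ :=
  ∫⁻ t in Icc (0 : ℝ) 1, ENNReal.ofReal (fubiniStudyNorm c (γ t) (velocity γ t))

/-- The Fubini-Study distance: the infimum of the lengths of the continuously differentiable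
curves that join two points. -/
def fubiniStudyDist (c : ℝ) (K L : ℙ ℂ H) : ℝ :=
  (⨅ (γ : ℝ → ℙ ℂ H) (_ : IsC1Curve γ) (_ : γ 0 = K) (_ : γ 1 = L),
    fubiniStudyLength c γ).toReal

/-- The group of isometries of `ℙH` for the Fubini-Study distance. -/
def isometryGroup (H : Type*) [NormedAddCommGroup H] [InnerProductSpace ℂ H] [CompleteSpace H]
    (c : ℝ) : Subgroup (Equiv.Perm (ℙ ℂ H)) :=
  symmetryGroup (fubiniStudyDist c)

end

end

end QuantumGeometry

namespace QuantumGeometry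

noncomputable section

/-! ### Lines, charts and the metric in terms of arbitrary nonzero vectors -/

section

variable {H : Type*} [NormedAddCommGroup H] [InnerProductSpace ℂ H]

/-! The distance is a function of the transition probability: `d = √c · θ` with `θ = arccos √p` the
angle between lines (`fubiniStudyDist_eq`). As `p = cos² θ` conversely and `√c ≠ 0`, a bijection
preserves `p` exactly when it preserves `d`.

Since `L` is one-dimensional, `Tr(f* f) = ‖f‖²`, so the metric is `√c` times the operator norm
(`fubiniStudyNorm_eq`). For the lower bound on lengths, a line at angle `θ < π/2` from `L` is the
graph of a map of norm `tan θ ≥ θ`. With the triangle inequality for angles, the angle from the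
starting point of a curve therefore grows no faster than the speed, and integrating gives
`IsC1Curve.lineAngle_le_integral`. For the upper bound, the great circle arc between unit vectors
with suitable phases has speed at most `θ` (`exists_isC1Curve_norm_velocity_le`). -/

theorem self_mem_submodule_mk {w : H} (hw : w ≠ 0) :
    w ∈ (Projectivization.mk ℂ w hw).submodule := by
  rw [Projectivization.submodule_mk]
  exact Submodule.mem_span_singleton_self _

theorem submodule_eq_span {L : ℙ ℂ H} {v : H} (hv : v ∈ L.submodule) (h0 : v ≠ 0) :
    L.submodule = Submodule.span ℂ {v} := by
  rw [Projectivization.submodule_eq, Submodule.mem_span_singleton] at hv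
  obtain ⟨a, rfl⟩ := hv
  have ha : a ≠ 0 := fun h => h0 (by rw [h, zero_smul])
  rw [Projectivization.submodule_eq]
  exact (Submodule.span_singleton_smul_eq (IsUnit.mk0 a ha) _).symm

theorem eq_mk_of_mem {L : ℙ ℂ H} {v : H} (hv : v ∈ L.submodule) (h0 : v ≠ 0) :
    L = Projectivization.mk ℂ v h0 := by
  apply Projectivization.submodule_injective
  rw [submodule_eq_span hv h0, Projectivization.submodule_mk]

theorem exists_unit_mem (L : ℙ ℂ H) : ∃ v ∈ L.submodule, ‖v‖ = 1 := by
  refine ⟨(‖L.rep‖⁻¹ : ℂ) • L.rep, L.submodule.smul_mem _ (rep_mem L), ?_⟩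
  rw [norm_smul]
  simp [L.rep_nonzero]

theorem coe_orthogonalProjectionOnto {L : ℙ ℂ H} {v : H} (hv : v ∈ L.submodule) (h0 : v ≠ 0)
    (x : H) : (L.submodule.orthogonalProjectionOnto x : H) =
      (inner ℂ v x / (‖v‖ ^ 2 : ℝ)) • v := by
  have key : ∀ (S : Submodule ℂ H) [S.HasOrthogonalProjection], S = Submodule.span ℂ {v} →
      (S.orthogonalProjectionOnto x : H) = (inner ℂ v x / (‖v‖ ^ 2 : ℝ)) • v := by
    rintro S _ rfl
    exact Submodule.starProjection_singleton ℂ x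
  exact key _ (submodule_eq_span hv h0)

theorem coe_orthogonalProjectionOnto_orthogonal {L : ℙ ℂ H} {v : H} (hv : v ∈ L.submodule)
    (h0 : v ≠ 0) (x : H) : (L.submoduleᗮ.orthogonalProjectionOnto x : H) =
      x - (inner ℂ v x / (‖v‖ ^ 2 : ℝ)) • v := by
  rw [← coe_orthogonalProjectionOnto hv h0, eq_sub_iff_add_eq, add_comm]
  exact Submodule.starProjection_add_starProjection_orthogonal (K := L.submodule) x

/-- The linear map sending `y` to `x ↦ ⟨v, x⟩ y`, from `Lᗮ` to the tangent space at `L`. -/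
def tangentOfPerp {L : ℙ ℂ H} (v : L.submodule) : L.submoduleᗮ →L[ℂ] Tangent L :=
  ContinuousLinearMap.smulRightL ℂ _ _ (innerSL ℂ v)

theorem tangentOfPerp_apply {L : ℙ ℂ H} (v : L.submodule) (y : L.submoduleᗮ) (x : L.submodule) :
    tangentOfPerp v y x = inner ℂ v x • y := rfl

theorem norm_tangentOfPerp {L : ℙ ℂ H} (v : L.submodule) (y : L.submoduleᗮ) :
    ‖tangentOfPerp v y‖ = ‖v‖ * ‖y‖ := by
  have := ContinuousLinearMap.norm_smulRight_apply (innerSL ℂ v) y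
  rwa [innerSL_apply_norm] at this

/-- Frees the chart from the chosen representatives: rescaling `w` cancels between the inverse and
the projection. A curve of lines can then be differentiated through any lift to `H`. -/
theorem graphCoord_eq {L K : ℙ ℂ H} (v : L.submodule) (hv : v ≠ 0) {w : H}
    (hw : w ∈ K.submodule) (h0 : w ≠ 0) :
    graphCoord L K =
      tangentOfPerp v ((inner ℂ (v : H) w)⁻¹ • L.submoduleᗮ.orthogonalProjectionOnto w) := by
  have hv' : (v : H) ≠ 0 := fun h => hv (Subtype.ext h)
  have hr : K.rep ∈ K.submodule := rep_mem K
  rw [submodule_eq_span hw h0, Submodule.mem_span_singleton] at hr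
  obtain ⟨a, ha⟩ := hr
  have ha0 : a ≠ 0 := by
    rintro rfl
    exact K.rep_nonzero (by rw [← ha, zero_smul])
  have hP : L.submodule.orthogonalProjectionOnto K.rep =
      (a * (inner ℂ (v : H) w / (‖(v : H)‖ ^ 2 : ℝ))) • v := by
    apply Subtype.ext
    rw [← ha, map_smul, Submodule.coe_smul, coe_orthogonalProjectionOnto v.2 hv', Submodule.coe_smul,
      smul_smul]
  have hn : (‖(v : H)‖ : ℂ) ≠ 0 := by exact_mod_cast norm_ne_zero_iff.2 hv'
  refine tangent_ext L _ _ v hv ?_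
  -- For orthogonal lines both sides are zero, the right one because `0⁻¹ = 0`.
  by_cases hi : inner ℂ (v : H) w = 0
  · have : L.submodule.orthogonalProjectionOnto K.rep = 0 := by
      rw [hP, hi]; simp
    rw [graphCoord, this, hi]
    simp
  · have hPv : L.submodule.orthogonalProjectionOnto K.rep ≠ 0 := by
      rw [hP]
      refine smul_ne_zero (mul_ne_zero ha0 (div_ne_zero hi ?_)) hv
      push_cast
      exact pow_ne_zero 2 hn
    have h := graphCoord_apply L K hPv
    rw [hP, map_smul, ← ha, map_smul] at h
    rw [tangentOfPerp_apply, smul_smul]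
    have h2 := congrArg (fun z => (a * (inner ℂ (v : H) w / (‖(v : H)‖ ^ 2 : ℝ)))⁻¹ • z) h
    simp only [smul_smul] at h2
    rw [inv_mul_cancel₀, one_smul] at h2
    · rw [h2]
      congr 1
      have hvv : inner ℂ v v = ((‖(v : H)‖ : ℝ) : ℂ) ^ 2 := inner_self_eq_norm_sq_to_K (𝕜 := ℂ) v
      rw [hvv]
      push_cast
      field_simp
    · refine mul_ne_zero ha0 (div_ne_zero hi ?_)
      push_cast
      exact pow_ne_zero 2 hn

variable [CompleteSpace H]

theorem fubiniStudyNorm_eq (c : ℝ) (L : ℙ ℂ H) (f : Tangent L) :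
    fubiniStudyNorm c L f = √c * ‖f‖ := by
  have : CompleteSpace L.submodule := FiniteDimensional.complete ℂ L.submodule
  obtain ⟨v, hvL, hv1⟩ := exists_unit_mem L
  set u : L.submodule := ⟨v, hvL⟩ with hu
  have hu1 : ‖u‖ = 1 := hv1
  have hu0 : u ≠ 0 := fun h => by rw [h, norm_zero] at hu1; exact zero_ne_one hu1
  have hf : f = tangentOfPerp u (f u) := by
    refine tangent_ext L _ _ u hu0 ?_
    rw [tangentOfPerp_apply, inner_self_eq_norm_sq_to_K, hu1]
    simp
  have hfn : ‖f‖ = ‖f u‖ := by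
    conv_lhs => rw [hf, norm_tangentOfPerp, hu1, one_mul]
  have huL : ∀ x : L.submodule, ∃ a : ℂ, x = a • u := by
    intro x
    obtain ⟨a, ha⟩ := Submodule.mem_span_singleton.1
      ((submodule_eq_span hvL (by rintro rfl; simp at hv1)).le x.2)
    exact ⟨a, Subtype.ext ha.symm⟩
  -- On the line `L`, `f* f` is a scalar; pairing `f* f u` with `u` gives its value `‖f u‖² = ‖f‖²`.
  have key : ((ContinuousLinearMap.adjoint f ∘L f : L.submodule →L[ℂ] L.submodule) :
      L.submodule →ₗ[ℂ] L.submodule) = ((‖f‖ : ℂ) ^ 2) • LinearMap.id := by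
    obtain ⟨b, hb⟩ := huL (ContinuousLinearMap.adjoint f (f u))
    have hbn : b = (‖f‖ : ℂ) ^ 2 := by
      have h1 : inner ℂ u (ContinuousLinearMap.adjoint f (f u)) = (‖f‖ : ℂ) ^ 2 := by
        rw [ContinuousLinearMap.adjoint_inner_right, inner_self_eq_norm_sq_to_K, hfn]
        rfl
      rw [hb, inner_smul_right, inner_self_eq_norm_sq_to_K, hu1] at h1
      simpa using h1
    ext1 x
    obtain ⟨a, rfl⟩ := huL x
    simp only [map_smul, ContinuousLinearMap.coe_coe, ContinuousLinearMap.comp_apply,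
      LinearMap.smul_apply, LinearMap.id_apply]
    rw [hb, hbn]
  rw [fubiniStudyNorm, fubiniStudyInner, key, map_smul, LinearMap.trace_id,
    Projectivization.finrank_submodule]
  have : ((c : ℂ) * ((‖f‖ : ℂ) ^ 2 • ((1 : ℕ) : ℂ))).re = c * ‖f‖ ^ 2 := by
    rw [smul_eq_mul, Nat.cast_one, mul_one]
    norm_cast
  rw [this, Real.sqrt_mul' _ (sq_nonneg _), Real.sqrt_sq]
  exact norm_nonneg f

end

/-! ### The angle between lines -/

section

variable {H : Type*} [NormedAddCommGroup H] [InnerProductSpace ℂ H]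

/-- The angle between two complex lines. -/
def lineAngle (K L : ℙ ℂ H) : ℝ :=
  Real.arccos √(transitionProb K L)

theorem lineAngle_eq {K L : ℙ ℂ H} {v w : H} (hv : v ∈ K.submodule) (hw : w ∈ L.submodule)
    (nv : ‖v‖ = 1) (nw : ‖w‖ = 1) : lineAngle K L = Real.arccos ‖inner ℂ v w‖ := by
  rw [lineAngle, transitionProb_eq hv hw nv nw, Real.sqrt_sq (norm_nonneg _)]

theorem lineAngle_self (K : ℙ ℂ H) : lineAngle K K = 0 := by
  obtain ⟨v, hv, nv⟩ := exists_unit_mem K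
  rw [lineAngle_eq hv hv nv nv, inner_self_eq_norm_sq_to_K, nv]
  simp

theorem lineAngle_comm (K L : ℙ ℂ H) : lineAngle K L = lineAngle L K := by
  obtain ⟨v, hv, nv⟩ := exists_unit_mem K
  obtain ⟨w, hw, nw⟩ := exists_unit_mem L
  rw [lineAngle_eq hv hw nv nw, lineAngle_eq hw hv nw nv, norm_inner_symm]

/-- Every line contains a unit vector whose inner product with a given vector is a nonnegative
real number. -/
theorem exists_unit_mem_inner_eq_norm (L : ℙ ℂ H) (v : H) :
    ∃ w ∈ L.submodule, ‖w‖ = 1 ∧ inner ℂ v w = (‖inner ℂ v w‖ : ℂ) := by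
  obtain ⟨w, hw, nw⟩ := exists_unit_mem L
  by_cases h : inner ℂ v w = 0
  · exact ⟨w, hw, nw, by simp [h]⟩
  have hn : (‖inner ℂ v w‖ : ℂ) ≠ 0 := by exact_mod_cast norm_ne_zero_iff.2 h
  have hi : inner ℂ v (((‖inner ℂ v w‖ : ℂ) / inner ℂ v w) • w) = (‖inner ℂ v w‖ : ℂ) := by
    rw [inner_smul_right, div_mul_cancel₀ _ h]
  refine ⟨((‖inner ℂ v w‖ : ℂ) / inner ℂ v w) • w, L.submodule.smul_mem _ hw, ?_, ?_⟩
  · rw [norm_smul, norm_div, nw]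
    simp [h]
  · rw [hi]
    simp

/-- The triangle inequality on the unit sphere of the underlying real space, whose inner product is
the real part of the hermitian one. -/
theorem arccos_re_inner_triangle {u v w : H} (nu : ‖u‖ = 1) (nv : ‖v‖ = 1) (nw : ‖w‖ = 1) :
    Real.arccos (inner ℂ u w).re ≤ Real.arccos (inner ℂ u v).re + Real.arccos (inner ℂ v w).re := by
  let _ : InnerProductSpace ℝ H := InnerProductSpace.rclikeToReal ℂ H
  have h := InnerProductGeometry.angle_le_angle_add_angle u v w
  unfold InnerProductGeometry.angle at h
  rw [nu, nv, nw, mul_one, div_one, div_one, div_one] at h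
  exact h

/-- With the phases of `u` and `w` adjusted to `v`, the two angles at `v` are real spherical angles.
The one between `u` and `w` can only exceed the angle of their lines, because `Re z ≤ ‖z‖`. -/
theorem lineAngle_triangle (K L M : ℙ ℂ H) :
    lineAngle K M ≤ lineAngle K L + lineAngle L M := by
  obtain ⟨v, hv, nv⟩ := exists_unit_mem L
  obtain ⟨u, hu, nu, eu⟩ := exists_unit_mem_inner_eq_norm K v
  obtain ⟨w, hw, nw, ew⟩ := exists_unit_mem_inner_eq_norm M v
  have eu' : inner ℂ u v = (‖inner ℂ u v‖ : ℂ) := by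
    rw [← inner_conj_symm, eu]
    simp
  rw [lineAngle_eq hu hw nu nw, lineAngle_eq hu hv nu nv, lineAngle_eq hv hw nv nw]
  have h := arccos_re_inner_triangle nu nv nw
  rw [eu', ew, Complex.ofReal_re, Complex.ofReal_re] at h
  refine le_trans (Real.arccos_le_arccos ?_) h
  exact Complex.re_le_norm _

/-- The norm is the ratio `sin θ / cos θ` of the two projections of a unit vector of `K`, and `θ ≤
tan θ`. -/
theorem lineAngle_le_norm_graphCoord {L K : ℙ ℂ H} (h : K ∈ (graphChart L).source) :
    lineAngle L K ≤ ‖graphCoord L K‖ := by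
  obtain ⟨v, hv, nv⟩ := exists_unit_mem L
  obtain ⟨w, hw, nw⟩ := exists_unit_mem K
  have hv0 : v ≠ 0 := by rintro rfl; simp at nv
  have hw0 : w ≠ 0 := by rintro rfl; simp at nw
  have hi : inner ℂ v w ≠ 0 := by
    intro hi
    apply h
    rw [submodule_eq_span hv hv0, submodule_eq_span hw hw0, Submodule.isOrtho_span]
    rintro _ rfl _ rfl
    rw [← inner_conj_symm, hi, map_zero]
  have hpos : 0 < ‖inner ℂ v w‖ := norm_pos_iff.2 hi
  have hP : ‖L.submodule.orthogonalProjectionOnto w‖ = ‖inner ℂ v w‖ := by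
    change ‖(L.submodule.orthogonalProjectionOnto w : H)‖ = _
    rw [coe_orthogonalProjectionOnto hv hv0, norm_smul, nv]
    simp
  have hQ : ‖L.submoduleᗮ.orthogonalProjectionOnto w‖ = √(1 - ‖inner ℂ v w‖ ^ 2) := by
    have := Submodule.norm_sq_eq_add_norm_sq_projection w L.submodule
    rw [hP, nw] at this
    rw [← Real.sqrt_sq (norm_nonneg (L.submoduleᗮ.orthogonalProjectionOnto w))]
    congr 1
    linarith
  rw [lineAngle_eq hv hw nv nw, graphCoord_eq ⟨v, hv⟩ (fun e => hv0 (congrArg Subtype.val e)) hw hw0,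
    norm_tangentOfPerp, norm_smul, hQ, norm_inv]
  have h1 : ‖(⟨v, hv⟩ : L.submodule)‖ = 1 := nv
  rw [h1, one_mul, mul_comm, ← div_eq_mul_inv, ← Real.tan_arccos]
  exact Real.le_tan (Real.arccos_nonneg _) (Real.arccos_lt_pi_div_two.2 hpos)

end

/-! ### Lifts and speeds of curves -/

section

variable {H : Type*} [NormedAddCommGroup H] [InnerProductSpace ℂ H]

theorem contDiff_smulRight {E F : Type*} [NormedAddCommGroup E] [NormedSpace ℂ E]
    [NormedAddCommGroup F] [NormedSpace ℂ F] (f : StrongDual ℂ E) :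
    ContDiff ℝ 1 (fun y : F => f.smulRight y) :=
  (ContinuousLinearMap.smulRightL ℂ E F f).contDiff.restrict_scalars ℝ

theorem hasDerivWithinAt_smulRight {E F : Type*} [NormedAddCommGroup E] [NormedSpace ℂ E]
    [NormedAddCommGroup F] [NormedSpace ℂ F] (f : StrongDual ℂ E) {g : ℝ → F} {g' : F} {S : Set ℝ}
    {t : ℝ} (hg : HasDerivWithinAt g g' S t) :
    HasDerivWithinAt (fun s => f.smulRight (g s)) (f.smulRight g') S t :=
  ((ContinuousLinearMap.smulRightL ℂ E F f).restrictScalars ℝ).hasFDerivAt.comp_hasDerivWithinAt t hg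

theorem mem_graphChart_source_iff {L K : ℙ ℂ H} {v w : H} (hv : v ∈ L.submodule) (hv0 : v ≠ 0)
    (hw : w ∈ K.submodule) (hw0 : w ≠ 0) :
    K ∈ (graphChart L).source ↔ inner ℂ v w ≠ 0 := by
  refine not_congr ?_
  rw [submodule_eq_span hv hv0, submodule_eq_span hw hw0, Submodule.isOrtho_span]
  constructor
  · intro h
    rw [← inner_conj_symm, h rfl rfl, map_zero]
  · rintro h _ rfl _ rfl
    rw [← inner_conj_symm, h, map_zero]

theorem graphCoord_eventuallyEq {L : ℙ ℂ H} {γ : ℝ → ℙ ℂ H} {w : ℝ → H} {S : Set ℝ} {t : ℝ}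
    (hγ : ∀ᶠ s in nhdsWithin t S, w s ≠ 0 ∧ w s ∈ (γ s).submodule) (v : L.submodule)
    (hv : v ≠ 0) :
    (fun s => graphChart L (γ s)) =ᶠ[nhdsWithin t S] fun s =>
      tangentOfPerp v ((inner ℂ (v : H) (w s))⁻¹ • L.submoduleᗮ.orthogonalProjectionOnto (w s)) := by
  filter_upwards [hγ] with s hs
  exact graphCoord_eq v hv hs.2 hs.1

/-- The velocity of the curve `s ↦ ℂ w(s)` at time `t` sends `w(t)` to the component of `w'(t)`
orthogonal to `w(t)`. -/
theorem velocity_eq {γ : ℝ → ℙ ℂ H} {w : ℝ → H} {w' : H} {t : ℝ} (ht : t ∈ Icc (0 : ℝ) 1)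
    (hw : HasDerivWithinAt w w' (Icc 0 1) t) (h0 : w t ≠ 0) (hmem : w t ∈ (γ t).submodule)
    (hγ : ∀ᶠ s in nhdsWithin t (Icc 0 1), w s ≠ 0 ∧ w s ∈ (γ s).submodule) :
    velocity γ t = tangentOfPerp ⟨w t, hmem⟩
      ((inner ℂ (w t) (w t))⁻¹ • (γ t).submoduleᗮ.orthogonalProjectionOnto w') := by
  set v : (γ t).submodule := ⟨w t, hmem⟩ with hv
  have hv0 : v ≠ 0 := fun e => h0 (congrArg Subtype.val e)
  have hin : inner ℂ (w t) (w t) ≠ 0 := inner_self_ne_zero.2 h0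
  have h1 : HasDerivWithinAt (fun s => inner ℂ (w t) (w s)) (inner ℂ (w t) w') (Icc 0 1) t :=
    ((innerSL ℂ (w t)).restrictScalars ℝ).hasFDerivAt.comp_hasDerivWithinAt t hw
  have h2 : HasDerivWithinAt (fun s => (γ t).submoduleᗮ.orthogonalProjectionOnto (w s))
      ((γ t).submoduleᗮ.orthogonalProjectionOnto w') (Icc 0 1) t :=
    (((γ t).submoduleᗮ.orthogonalProjectionOnto).restrictScalars ℝ).hasFDerivAt.comp_hasDerivWithinAt
      t hw
  have h3 := (h1.fun_inv hin).fun_smul h2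
  -- This kills the product rule term that contains the derivative of the inverse.
  have hz : (γ t).submoduleᗮ.orthogonalProjectionOnto (w t) = 0 :=
    Submodule.orthogonalProjectionOnto_orthogonal_apply_eq_zero hmem
  rw [hz, smul_zero, add_zero] at h3
  have h4 := hasDerivWithinAt_smulRight (innerSL ℂ v) h3
  have h5 := h4.congr_of_eventuallyEq (graphCoord_eventuallyEq hγ v hv0)
    (graphCoord_eq v hv0 hmem h0)
  exact h5.derivWithin (uniqueDiffOn_Icc zero_lt_one t ht)

/-- Expresses the speed inside the fixed space `H`, while the velocities lie in tangent spaces that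
vary with `t`; its continuity can then be read off. -/
theorem norm_velocity {γ : ℝ → ℙ ℂ H} {w : ℝ → H} {w' : H} {t : ℝ} (ht : t ∈ Icc (0 : ℝ) 1)
    (hw : HasDerivWithinAt w w' (Icc 0 1) t) (h0 : w t ≠ 0) (hmem : w t ∈ (γ t).submodule)
    (hγ : ∀ᶠ s in nhdsWithin t (Icc 0 1), w s ≠ 0 ∧ w s ∈ (γ s).submodule) :
    ‖velocity γ t‖ = ‖w t‖⁻¹ * ‖w' - (inner ℂ (w t) w' / (‖w t‖ ^ 2 : ℝ)) • w t‖ := by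
  rw [velocity_eq ht hw h0 hmem hγ, norm_tangentOfPerp, norm_smul, norm_inv,
    ← coe_orthogonalProjectionOnto_orthogonal hmem h0, inner_self_eq_norm_sq_to_K]
  have h1 : ‖(⟨w t, hmem⟩ : (γ t).submodule)‖ = ‖w t‖ := rfl
  have h2 : ‖w t‖ ≠ 0 := norm_ne_zero_iff.2 h0
  rw [h1, ← mul_assoc]
  congr 1
  rw [norm_pow, RCLike.norm_ofReal, abs_norm]
  field_simp

theorem isC1Curve_mk {γ : ℝ → ℙ ℂ H} {w : ℝ → H} (hw : ContDiff ℝ 1 w) (h0 : ∀ t, w t ≠ 0)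
    (hγ : ∀ t, w t ∈ (γ t).submodule) : IsC1Curve γ := by
  intro t ht
  have hin : inner ℂ (w t) (w t) ≠ 0 := inner_self_ne_zero.2 (h0 t)
  have h1 : ContDiff ℝ 1 (fun s => inner ℂ (w t) (w s)) :=
    ((innerSL ℂ (w t)).restrictScalars ℝ).contDiff.comp hw
  have h2 : ContDiff ℝ 1 (fun s => (γ t).submoduleᗮ.orthogonalProjectionOnto (w s)) :=
    (((γ t).submoduleᗮ.orthogonalProjectionOnto).restrictScalars ℝ).contDiff.comp hw
  constructor
  · have : ∀ᶠ s in nhds t, inner ℂ (w t) (w s) ≠ 0 :=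
      h1.continuous.continuousAt.eventually_ne hin
    filter_upwards [nhdsWithin_le_nhds this] with s hs
    exact (mem_graphChart_source_iff (hγ t) (h0 t) (hγ s) (h0 s)).2 hs
  · have h4 := contDiff_smulRight (F := (γ t).submoduleᗮ)
      (innerSL ℂ (⟨w t, hγ t⟩ : (γ t).submodule))
    have h3 := h4.contDiffAt.comp t ((h1.contDiffAt.inv hin).smul h2.contDiffAt)
    have hv0 : (⟨w t, hγ t⟩ : (γ t).submodule) ≠ 0 := fun e => h0 t (congrArg Subtype.val e)
    exact h3.contDiffWithinAt.congr_of_eventuallyEq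
      (graphCoord_eventuallyEq (.of_forall fun s => ⟨h0 s, hγ s⟩) _ hv0)
      (graphCoord_eq _ hv0 (hγ t) (h0 t))

/-- Near `t` the line `γ s` is the graph of its chart coordinate, so the point of the graph over a
fixed vector of `γ t` is a lift. A local lift suffices, as speed is a local notion. -/
theorem IsC1Curve.exists_lift {γ : ℝ → ℙ ℂ H} (hγ : IsC1Curve γ) {t : ℝ} (ht : t ∈ Icc (0 : ℝ) 1) :
    ∃ w : ℝ → H, ContDiffWithinAt ℝ 1 w (Icc 0 1) t ∧
      (∀ᶠ s in nhdsWithin t (Icc 0 1), w s ≠ 0 ∧ w s ∈ (γ s).submodule) := by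
  obtain ⟨h1, h2⟩ := hγ t ht
  set v : (γ t).submodule := ⟨(γ t).rep, rep_mem _⟩
  refine ⟨fun s => (v : H) + (graphChart (γ t) (γ s) v : H), ?_, ?_⟩
  · have e : ContDiff ℝ 1 (fun f : Tangent (γ t) => (v : H) + (f v : H)) :=
      contDiff_const.add ((((γ t).submoduleᗮ.subtypeL ∘L
        ContinuousLinearMap.apply ℂ (γ t).submoduleᗮ v).restrictScalars ℝ).contDiff)
    exact e.contDiffAt.comp_contDiffWithinAt t h2
  · filter_upwards [h1] with s hs
    refine ⟨graph_ne_zero (γ t) _, ?_⟩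
    have := (mem_graphLine (γ t) (graphChart (γ t) (γ s)) _).2 ⟨v, rfl⟩
    have e : graphLine (γ t) (graphChart (γ t) (γ s)) = γ s := (graphChart (γ t)).left_inv hs
    rwa [e] at this

theorem IsC1Curve.continuousOn_norm_velocity {γ : ℝ → ℙ ℂ H} (hγ : IsC1Curve γ) :
    ContinuousOn (fun t => ‖velocity γ t‖) (Icc 0 1) := by
  intro t ht
  obtain ⟨w, hw, hmem⟩ := hγ.exists_lift ht
  have hu : UniqueDiffOn ℝ (Icc (0 : ℝ) 1) := uniqueDiffOn_Icc zero_lt_one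
  have hd : ContinuousWithinAt (derivWithin w (Icc 0 1)) (Icc 0 1) t := by
    have := (hw.fderivWithin_right (m := 0) hu (by simp) ht).continuousWithinAt
    exact this.clm_apply continuousWithinAt_const
  have hc := hw.continuousWithinAt
  have hself := hmem.self_of_nhdsWithin ht
  have hev : (fun s => ‖velocity γ s‖) =ᶠ[nhdsWithin t (Icc 0 1)] fun s => ‖w s‖⁻¹ *
      ‖derivWithin w (Icc 0 1) s -
        (inner ℂ (w s) (derivWithin w (Icc 0 1) s) / (‖w s‖ ^ 2 : ℝ)) • w s‖ := by
    have hdiff := hw.eventually (by simp)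
    rw [insert_eq_of_mem ht] at hdiff
    -- The speed formula at `s` needs the lift on a whole neighbourhood of `s`, hence the nested
    -- `eventually`.
    filter_upwards [hdiff, eventually_eventually_nhdsWithin.2 hmem, hmem, self_mem_nhdsWithin]
      with s h1 h2 h3 h4
    exact norm_velocity h4 (h1.differentiableWithinAt (by simp)).hasDerivWithinAt h3.1 h3.2 h2
  refine ContinuousWithinAt.congr_of_eventuallyEq ?_ hev (hev.self_of_nhdsWithin ht)
  have hn : ‖w t‖ ≠ 0 := norm_ne_zero_iff.2 hself.1
  refine (hc.norm.inv₀ hn).mul (ContinuousWithinAt.norm ?_)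
  have hip : ContinuousWithinAt (fun s => inner ℂ (w s) (derivWithin w (Icc 0 1) s)) (Icc 0 1) t :=
    Filter.Tendsto.inner hc hd
  refine hd.sub (ContinuousWithinAt.smul (ContinuousWithinAt.div hip ?_ ?_) hc)
  · exact Complex.continuous_ofReal.continuousAt.comp_continuousWithinAt (hc.norm.pow 2)
  · exact_mod_cast pow_ne_zero 2 hn

end

/-! ### The distance is `√c` times the angle -/

section

variable {H : Type*} [NormedAddCommGroup H] [InnerProductSpace ℂ H]

theorem graphCoord_self (L : ℙ ℂ H) : graphCoord L L = 0 := by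
  have h : (⟨L.rep, rep_mem L⟩ : L.submodule) ≠ 0 := fun e => L.rep_nonzero (congrArg Subtype.val e)
  rw [graphCoord_eq _ h (rep_mem L) L.rep_nonzero,
    Submodule.orthogonalProjectionOnto_orthogonal_apply_eq_zero (rep_mem L), smul_zero, map_zero]

theorem abs_lineAngle_sub_le (K L M : ℙ ℂ H) :
    |lineAngle K M - lineAngle K L| ≤ lineAngle L M := by
  have h1 := lineAngle_triangle K L M
  have h2 := lineAngle_triangle K M L
  rw [lineAngle_comm M L] at h2
  rw [abs_le]
  constructor <;> linarith

theorem eventually_norm_lt_of_norm_derivWithin_lt {E : Type*} [NormedAddCommGroup E]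
    [NormedSpace ℝ E] {f : ℝ → E} {S : Set ℝ} {t r : ℝ} (hf : ContDiffWithinAt ℝ 1 f S t)
    (h0 : f t = 0) (hr : ‖derivWithin f S t‖ < r) :
    ∀ᶠ z in nhdsWithin t S, ‖z - t‖⁻¹ * ‖f z‖ < r := by
  have h := (hf.differentiableWithinAt (by simp)).hasDerivWithinAt.limsup_slope_norm_le hr
  simpa only [h0, norm_zero, sub_zero] using h

theorem tendsto_norm_of_contDiffWithinAt {E : Type*} [NormedAddCommGroup E]
    [NormedSpace ℝ E] {f : ℝ → E} {S : Set ℝ} {t : ℝ} (hf : ContDiffWithinAt ℝ 1 f S t)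
    (h0 : f t = 0) : Filter.Tendsto (fun s => ‖f s‖) (nhdsWithin t S) (nhds 0) :=
  tendsto_zero_iff_norm_tendsto_zero.1 (h0 ▸ hf.continuousWithinAt)

theorem IsC1Curve.continuousOn_lineAngle {γ : ℝ → ℙ ℂ H} (hγ : IsC1Curve γ) (K : ℙ ℂ H) :
    ContinuousOn (fun t => lineAngle K (γ t)) (Icc 0 1) := by
  intro t ht
  have h1 : Filter.Tendsto (fun s => ‖graphChart (γ t) (γ s)‖) (nhdsWithin t (Icc 0 1))
      (nhds 0) := tendsto_norm_of_contDiffWithinAt (hγ t ht).2 (graphCoord_self _)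
  rw [ContinuousWithinAt, tendsto_iff_dist_tendsto_zero]
  refine squeeze_zero' (.of_forall fun _ => dist_nonneg) ?_ h1
  filter_upwards [(hγ t ht).1] with s hs
  exact (abs_lineAngle_sub_le K (γ t) (γ s)).trans (lineAngle_le_norm_graphCoord hs)

/-- The angle between the end points of a curve is at most the integral of its speed. -/
theorem IsC1Curve.lineAngle_le_integral {γ : ℝ → ℙ ℂ H} (hγ : IsC1Curve γ) :
    lineAngle (γ 0) (γ 1) ≤ ∫ t in Icc (0 : ℝ) 1, ‖velocity γ t‖ := by
  -- Extending the speed continuously to `ℝ` makes its primitive differentiable everywhere, end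
  -- points included.
  set g : ℝ → ℝ := IccExtend zero_le_one ((Icc (0 : ℝ) 1).domRestrict fun t => ‖velocity γ t‖) with hg
  have hgc : Continuous g := hγ.continuousOn_norm_velocity.domRestrict.Icc_extend'
  have hge : ∀ t ∈ Icc (0 : ℝ) 1, g t = ‖velocity γ t‖ := fun t ht => IccExtend_of_mem _ _ ht
  have hB : ∀ x, HasDerivAt (fun x => ∫ t in (0 : ℝ)..x, g t) (g x) x := fun x =>
    intervalIntegral.integral_hasDerivAt_right (hgc.intervalIntegrable _ _)
      (hgc.stronglyMeasurableAtFilter _ _) hgc.continuousAt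
  -- The angle need not be differentiable along the curve; this comparison asks only for a bound on
  -- its right slopes.
  have key := image_le_of_liminf_slope_right_le_deriv_boundary
    (hγ.continuousOn_lineAngle (γ 0)) (B := fun x => ∫ t in (0 : ℝ)..x, g t) (B' := g)
    (by simp [lineAngle_self]) (fun x _ => (hB x).continuousAt.continuousWithinAt)
    (fun x _ => (hB x).hasDerivWithinAt) ?_ (right_mem_Icc.2 zero_le_one)
  · refine key.trans_eq ?_
    rw [intervalIntegral.integral_of_le zero_le_one, ← integral_Icc_eq_integral_Ioc]
    exact setIntegral_congr_fun measurableSet_Icc hge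
  · intro x hx r hr
    have hx' : x ∈ Icc (0 : ℝ) 1 := Ico_subset_Icc_self hx
    rw [hge x hx'] at hr
    have hle : nhdsWithin x (Ioi x) ≤ nhdsWithin x (Icc 0 1) := by
      rw [← nhdsWithin_Ioo_eq_nhdsGT hx.2]
      exact nhdsWithin_mono x fun y hy => ⟨hx.1.trans hy.1.le, hy.2.le⟩
    -- The velocity at `x` is the derivative in the chart centred at `γ x`, where the coordinate
    -- vanishes; the chart norm in turn dominates the increment of the angle.
    have h1 := hle (eventually_norm_lt_of_norm_derivWithin_lt (hγ x hx').2
      (graphCoord_self _) hr)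
    have h2 := hle (hγ x hx').1
    refine Filter.Eventually.frequently ?_
    filter_upwards [h1, h2, self_mem_nhdsWithin] with z hz1 hz2 hz3
    have hz : 0 < z - x := sub_pos.2 hz3
    rw [Real.norm_of_nonneg hz.le] at hz1
    rw [slope_def_module, smul_eq_mul]
    refine lt_of_le_of_lt (mul_le_mul_of_nonneg_left ?_ (inv_nonneg.2 hz.le)) hz1
    exact (le_abs_self _).trans
      ((abs_lineAngle_sub_le _ _ _).trans (lineAngle_le_norm_graphCoord hz2))

/-- Two lines are joined by a curve whose speed is at most the angle between them. -/
theorem exists_isC1Curve_norm_velocity_le (K L : ℙ ℂ H) :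
    ∃ γ : ℝ → ℙ ℂ H, IsC1Curve γ ∧ γ 0 = K ∧ γ 1 = L ∧
      ∀ t ∈ Icc (0 : ℝ) 1, ‖velocity γ t‖ ≤ lineAngle K L := by
  obtain ⟨u, hu, nu⟩ := exists_unit_mem K
  obtain ⟨v, hv, nv, ev⟩ := exists_unit_mem_inner_eq_norm L u
  have hu0 : u ≠ 0 := by rintro rfl; simp at nu
  have hv0 : v ≠ 0 := by rintro rfl; simp at nv
  set a := lineAngle K L with ha
  have ha' : a = Real.arccos ‖inner ℂ u v‖ := lineAngle_eq hu hv nu nv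
  have hle : ‖inner ℂ u v‖ ≤ 1 := by
    have := norm_inner_le_norm (𝕜 := ℂ) u v
    rwa [nu, nv, one_mul] at this
  have hcos : Real.cos a = ‖inner ℂ u v‖ := by
    rw [ha', Real.cos_arccos (by linarith [norm_nonneg (inner ℂ u v : ℂ)]) hle]
  have huu : inner ℂ u u = (1 : ℂ) := by rw [inner_self_eq_norm_sq_to_K, nu]; simp
  have hvv : inner ℂ v v = (1 : ℂ) := by rw [inner_self_eq_norm_sq_to_K, nv]; simp
  have huv : inner ℂ u v = ((Real.cos a : ℝ) : ℂ) := by rw [ev, hcos]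
  have hvu : inner ℂ v u = ((Real.cos a : ℝ) : ℂ) := by
    rw [← inner_conj_symm, huv, Complex.conj_ofReal]
  -- `x` is the normalized component of `v` orthogonal to `u`. If `a = 0` then `v = u`, and `x = 0`
  -- is taken, since `H` may contain no unit vector orthogonal to `u`.
  obtain ⟨x, hx, nx, hxv⟩ : ∃ x : H, inner ℂ u x = (0 : ℂ) ∧ (a = 0 ∨ inner ℂ x x = (1 : ℂ)) ∧
      ((Real.cos a : ℝ) : ℂ) • u + ((Real.sin a : ℝ) : ℂ) • x = v := by
    by_cases hs : Real.sin a = 0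
    · have ha0 : a = 0 := by
        have h1 : 0 ≤ a := by rw [ha']; exact Real.arccos_nonneg _
        have h2 : a < Real.pi := by
          have : a ≤ Real.pi / 2 := by
            rw [ha']; exact Real.arccos_le_pi_div_two.2 (norm_nonneg _)
          linarith [Real.pi_pos]
        exact (Real.sin_eq_zero_iff_of_lt_of_lt (by linarith [Real.pi_pos]) h2).1 hs
      refine ⟨0, inner_zero_right _, Or.inl ha0, ?_⟩
      rw [ha0, Real.cos_zero] at huv hvu
      rw [ha0, Real.cos_zero, smul_zero, add_zero, Complex.ofReal_one, one_smul, ← sub_eq_zero,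
        ← inner_self_eq_zero (𝕜 := ℂ), inner_sub_left, inner_sub_right, inner_sub_right, huu, hvv,
        huv, hvu]
      simp
    · have hsc : ((Real.sin a : ℝ) : ℂ) ≠ 0 := by exact_mod_cast hs
      have hsq : ((Real.sin a : ℝ) : ℂ) ^ 2 + ((Real.cos a : ℝ) : ℂ) ^ 2 = 1 := by
        exact_mod_cast Real.sin_sq_add_cos_sq a
      refine ⟨((Real.sin a : ℝ) : ℂ)⁻¹ • (v - ((Real.cos a : ℝ) : ℂ) • u), ?_, Or.inr ?_, ?_⟩
      · rw [inner_smul_right, inner_sub_right, inner_smul_right, huu, huv]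
        simp
      · rw [inner_smul_right, inner_smul_left, inner_sub_right, inner_sub_left, inner_sub_left,
          inner_smul_right, inner_smul_right, inner_smul_left, inner_smul_left, huu, hvv, huv, hvu,
          map_inv₀, Complex.conj_ofReal, Complex.conj_ofReal]
        field_simp
        linear_combination -hsq
      · rw [smul_inv_smul₀ hsc]
        abel
  have hxu : inner ℂ x u = (0 : ℂ) := by rw [← inner_conj_symm, hx, map_zero]
  set w : ℝ → H := fun s => ((Real.cos (s * a) : ℝ) : ℂ) • u + ((Real.sin (s * a) : ℝ) : ℂ) • x
    with hw
  have hww : ∀ s, inner ℂ (w s) (w s) = (1 : ℂ) := by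
    intro s
    simp only [hw, inner_add_left, inner_add_right, inner_smul_left, inner_smul_right, hx, hxu, huu,
      Complex.conj_ofReal]
    have hsq : ((Real.sin (s * a) : ℝ) : ℂ) ^ 2 + ((Real.cos (s * a) : ℝ) : ℂ) ^ 2 = 1 := by
      exact_mod_cast Real.sin_sq_add_cos_sq (s * a)
    rcases nx with h | h
    · simp [h]
    · rw [h]
      linear_combination hsq
  have hw0 : ∀ s, w s ≠ 0 := fun s h => by
    have := hww s
    rw [h, inner_zero_left] at this
    exact zero_ne_one this
  have hC : ContDiff ℝ 1 w := by
    have h1 : ContDiff ℝ 1 (fun s : ℝ => ((Real.cos (s * a) : ℝ) : ℂ)) :=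
      Complex.ofRealCLM.contDiff.comp (Real.contDiff_cos.comp (contDiff_id.mul contDiff_const))
    have h2 : ContDiff ℝ 1 (fun s : ℝ => ((Real.sin (s * a) : ℝ) : ℂ)) :=
      Complex.ofRealCLM.contDiff.comp (Real.contDiff_sin.comp (contDiff_id.mul contDiff_const))
    exact (h1.smul contDiff_const).add (h2.smul contDiff_const)
  have hd : ∀ s, HasDerivAt w
      (((-Real.sin (s * a) * a : ℝ) : ℂ) • u + ((Real.cos (s * a) * a : ℝ) : ℂ) • x) s := by
    intro s
    have h0 : HasDerivAt (fun s : ℝ => s * a) a s := hasDerivAt_mul_const a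
    exact ((h0.cos.ofReal_comp).smul_const u).add ((h0.sin.ofReal_comp).smul_const x)
  refine ⟨fun s => Projectivization.mk ℂ (w s) (hw0 s),
    isC1Curve_mk hC hw0 fun s => self_mem_submodule_mk (hw0 s), ?_, ?_, ?_⟩
  · have : w 0 = u := by simp [hw]
    exact ((eq_mk_of_mem hu hu0).trans (by congr 1; exact this.symm)).symm
  · have : w 1 = v := by simpa [hw] using hxv
    exact ((eq_mk_of_mem hv hv0).trans (by congr 1; exact this.symm)).symm
  · intro t ht
    have nw : ‖w t‖ = 1 := by
      have h2 : ‖w t‖ ^ 2 = 1 := by rw [@norm_sq_eq_re_inner ℂ, hww]; simp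
      exact (pow_eq_one_iff_of_nonneg (norm_nonneg _) two_ne_zero).1 h2
    rw [norm_velocity (w := w) ht (hd t).hasDerivWithinAt (hw0 t) (self_mem_submodule_mk (hw0 t))
      (.of_forall fun s => ⟨hw0 s, self_mem_submodule_mk (hw0 s)⟩), nw]
    have ha0 : 0 ≤ a := by rw [ha']; exact Real.arccos_nonneg _
    rcases nx with h | h
    · simp [h]
    · set w' := ((-Real.sin (t * a) * a : ℝ) : ℂ) • u + ((Real.cos (t * a) * a : ℝ) : ℂ) • x with hw'
      -- The arc is horizontal: its derivative is already orthogonal to the complex line of `w t`,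
      -- so the speed is `‖w'‖ = a`.
      have ho : inner ℂ (w t) w' = (0 : ℂ) := by
        simp only [hw, hw', inner_add_left, inner_add_right, inner_smul_left, inner_smul_right, hx,
          hxu, huu, h, Complex.conj_ofReal]
        push_cast
        ring
      have hn : ‖w'‖ ^ 2 = a ^ 2 := by
        have h1 : inner ℂ w' w' = ((a ^ 2 : ℝ) : ℂ) := by
          have hsq : ((Real.sin (t * a) : ℝ) : ℂ) ^ 2 + ((Real.cos (t * a) : ℝ) : ℂ) ^ 2 = 1 := by
            exact_mod_cast Real.sin_sq_add_cos_sq (t * a)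
          simp only [hw', inner_add_left, inner_add_right, inner_smul_left, inner_smul_right, hx,
            hxu, huu, h, Complex.conj_ofReal]
          rw [Complex.ofReal_mul, Complex.ofReal_mul, Complex.ofReal_neg, Complex.ofReal_pow]
          linear_combination (a : ℂ) ^ 2 * hsq
        rw [@norm_sq_eq_re_inner ℂ, h1]
        exact Complex.ofReal_re _
      rw [ho, zero_div, zero_smul, sub_zero, inv_one, one_mul]
      exact (pow_le_pow_iff_left₀ (norm_nonneg _) ha0 two_ne_zero).1 hn.le

variable [CompleteSpace H]

theorem IsC1Curve.fubiniStudyLength_eq (c : ℝ) {γ : ℝ → ℙ ℂ H} (hγ : IsC1Curve γ) :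
    fubiniStudyLength c γ = ENNReal.ofReal (√c * ∫ t in Icc (0 : ℝ) 1, ‖velocity γ t‖) := by
  rw [fubiniStudyLength, ← integral_const_mul, ofReal_integral_eq_lintegral_ofReal]
  · simp_rw [fubiniStudyNorm_eq]
  · exact (hγ.continuousOn_norm_velocity.integrableOn_Icc).const_mul _
  · exact .of_forall fun t => mul_nonneg (Real.sqrt_nonneg _) (norm_nonneg (velocity γ t))

/-- The great circle arc attains the lower bound given by the angle. The infimum is thus finite and
`toReal` loses nothing. -/
theorem fubiniStudyDist_eq (c : ℝ) (K L : ℙ ℂ H) :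
    fubiniStudyDist c K L = √c * lineAngle K L := by
  have h : (⨅ (γ : ℝ → ℙ ℂ H) (_ : IsC1Curve γ) (_ : γ 0 = K) (_ : γ 1 = L),
      fubiniStudyLength c γ) = ENNReal.ofReal (√c * lineAngle K L) := by
    apply le_antisymm
    · obtain ⟨γ, hγ, h0, h1, hv⟩ := exists_isC1Curve_norm_velocity_le K L
      refine (iInf₂_le_of_le γ hγ (iInf₂_le h0 h1)).trans ?_
      rw [hγ.fubiniStudyLength_eq]
      refine ENNReal.ofReal_le_ofReal (mul_le_mul_of_nonneg_left ?_ (Real.sqrt_nonneg _))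
      have := setIntegral_mono_on (μ := volume) hγ.continuousOn_norm_velocity.integrableOn_Icc
        (continuousOn_const (c := lineAngle K L)).integrableOn_Icc measurableSet_Icc hv
      simpa using this
    · refine le_iInf₂ fun γ hγ => le_iInf₂ fun h0 h1 => ?_
      rw [hγ.fubiniStudyLength_eq, ← h0, ← h1]
      exact ENNReal.ofReal_le_ofReal
        (mul_le_mul_of_nonneg_left hγ.lineAngle_le_integral (Real.sqrt_nonneg _))
  rw [fubiniStudyDist, h, ENNReal.toReal_ofReal]
  exact mul_nonneg (Real.sqrt_nonneg _) (Real.arccos_nonneg _)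

end

/-- The angle determines the probability: by Cauchy–Schwarz the argument of `arccos` lies in its
proper range. -/
theorem transitionProb_eq_cos_lineAngle_sq {H : Type*} [NormedAddCommGroup H]
    [InnerProductSpace ℂ H] (K L : ℙ ℂ H) :
    transitionProb K L = Real.cos (lineAngle K L) ^ 2 := by
  obtain ⟨u, hu, nu⟩ := exists_unit_mem K
  obtain ⟨v, hv, nv⟩ := exists_unit_mem L
  have hle := norm_inner_le_norm (𝕜 := ℂ) u v
  rw [nu, nv, one_mul] at hle
  rw [lineAngle_eq hu hv nu nv, transitionProb_eq hu hv nu nv,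
    Real.cos_arccos (by linarith [norm_nonneg (inner ℂ u v : ℂ)]) hle]

end

end QuantumGeometry

theorem corollary2 (H : Type*) [NormedAddCommGroup H] [InnerProductSpace ℂ H] [CompleteSpace H]
    [TopologicalSpace.SeparableSpace H] (c : ℝ) (hc : 0 < c) :
    QuantumGeometry.quantumSymmetryGroup H = QuantumGeometry.isometryGroup H c := by
  have hc' : √c ≠ 0 := (Real.sqrt_pos.2 hc).ne'
  ext φ
  refine forall₂_congr fun K L => ?_
  rw [QuantumGeometry.fubiniStudyDist_eq, QuantumGeometry.fubiniStudyDist_eq,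
    mul_right_inj' hc']
  constructor
  · intro h
    rw [QuantumGeometry.lineAngle, QuantumGeometry.lineAngle, h]
  · intro h
    rw [QuantumGeometry.transitionProb_eq_cos_lineAngle_sq,
      QuantumGeometry.transitionProb_eq_cos_lineAngle_sq, h]
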